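/- \textbf{Lifting Lemma.} The category of (localic) spaces, or locales, is the opposite of the category of frames. The homset of maps $A\to B$ is partially ordered by the specialisation order: $f\sqsubseteq g$ iff $f^{*}U\le g^{*}U$ for every open $U$ of $B$; in particular the points of $B$ (the maps $1\to B$) are so ordered. A set is regarded as a discrete locale. Let $Y$ be a set with a binary relation $<$. An \emph{ideal} of $Y$ is a subset $I\subseteq Y$ such that $a<b\in I$ implies $a\in I$, and such that for each finite $F\subseteq I$ there is $b\in I$ with $a<b$ for all $a\in F$. Call $(Y,<)$ an \emph{$R$-structure} if $<$ is transitive (not necessarily irreflexive), dense ($a<b$ implies $a<c<b$ for some $c$), and $I_q:=\{q'\in Y\mid q'<q\}$ is an ideal for every $q\in Y$. The \emph{rounded ideal completion} $\mathsf{RIdl}(Y,<)$ is the localic space of ideals of $Y$: its frame of opens is the Lindenbaum algebra of the propositional geometric theory with a symbol $[y]$ (read ``$y\in I$'') for each $y\in Y$ and with the axioms $[b]\Rightarrow[a]$ for $a<b$ and $\bigwedge_{a\in F}[a]\Rightarrow\bigvee\{[b]\mid a<b\text{ for all }a\in F\}$ for finite $F\subseteq Y$. Let $(Y,<)$ be an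 $R$-structure. Then there is a map of locales $\phi\colon Y\to\mathsf{RIdl}(Y,<)$ which is a surjection (that is, an epimorphism of locales), which sends each $q\in Y$ to the ideal $I_q$, and such that, for every locale $X$, composition with $\phi$, $\overline f\mapsto\overline f\circ\phi$, is an equivalence (an isomorphism of posets for the specialisation orders, in particular a bijection) from the maps $\overline f\colon\mathsf{RIdl}(Y,<)\to X$ to the maps $f\colon Y\to X$ that satisfy, for all $q,q'\in Y$, (i) (monotonicity) $q'<q\implies f(q')\sqsubseteq f(q)$, and (ii) (continuity) $f(q)$ is the directed join $\bigsqcup^{\uparrow}_{q'<q}f(q')$ in the poset of points of $X$ under its specialisation order $\sqsubseteq$. -/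

import Mathlib

open CategoryTheory

universe u

namespace LiftingLemma

/-! ### The space of models of a propositional geometric theory -/

/-- A sequent `⋀ hyp ⇒ ⋁_{B ∈ concl} ⋀ B` of propositional geometric logic, over a signature `S` of
proposition symbols. -/
structure Sequent (S : Type u) where
  /-- The conjuncts of the left-hand side. -/
  hyp : Finset S
  /-- The disjuncts of the right-hand side, each a finite conjunction of symbols. -/
  concl : Set (Finset S)

/-- A propositional geometric theory, its axioms in the normal form of `Sequent`. -/
abbrev Theory (S : Type u) := Set (Sequent S)

/-- An element of the Lindenbaum algebra of `T`, that is, an open of the space of models of `T`.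
Every geometric formula is a disjunction of finite conjunctions of symbols; modulo provable
equivalence it is determined by the set of all finite conjunctions that entail it, and the sets
which arise in this way are those closed under weakening and under the covers given by the axioms
of `T`. -/
@[ext]
structure Opens {S : Type u} (T : Theory S) where
  /-- The finite conjunctions that entail the open. -/
  carrier : Set (Finset S)
  weaken : ∀ ⦃A B : Finset S⦄, A ⊆ B → A ∈ carrier → B ∈ carrier
  cover : ∀ σ ∈ T, ∀ C : Finset S, σ.hyp ⊆ C →
    (∀ B ∈ σ.concl, ∀ D : Finset S, C ⊆ D → B ⊆ D → D ∈ carrier) → C ∈ carrier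

namespace Opens

variable {S : Type u} {T : Theory S}

theorem carrier_injective : Function.Injective (carrier : Opens T → Set (Finset S)) :=
  fun _ _ h => Opens.ext h

/-- Opens are ordered by entailment, which is inclusion of carriers. -/
instance : PartialOrder (Opens T) := PartialOrder.lift carrier carrier_injective

instance : InfSet (Opens T) where
  sInf 𝒰 :=
    { carrier := {A | ∀ U ∈ 𝒰, A ∈ U.carrier}
      weaken := fun _ _ h hA U hU => U.weaken h (hA U hU)
      cover := fun σ hσ C hC h U hU =>
        U.cover σ hσ C hC fun B hB D hCD hBD => h B hB D hCD hBD U hU }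

instance : CompleteLattice (Opens T) :=
  completeLatticeOfInf _ fun _ =>
    ⟨fun U hU _ hA => hA U hU, fun _ hV _ hA _ hU => hV hU hA⟩

/-- The Heyting implication of opens, used only to see that the opens form a frame. -/
def imp (U V : Opens T) : Opens T where
  carrier := {C | ∀ D : Finset S, C ⊆ D → D ∈ U.carrier → D ∈ V.carrier}
  weaken _ _ h hA D hD := hA D (h.trans hD)
  cover σ hσ _ hC h D hD hDU :=
    V.cover σ hσ D (hC.trans hD) fun B hB E hDE hBE =>
      h B hB E (hD.trans hDE) hBE E (Finset.Subset.refl E) (U.weaken hDE hDU)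

theorem le_imp_iff (U V W : Opens T) : W ≤ imp U V ↔ U ⊓ W ≤ V := by
  constructor
  · intro h A hA
    exact h ((inf_le_right : U ⊓ W ≤ W) hA) A (Finset.Subset.refl A)
      ((inf_le_left : U ⊓ W ≤ U) hA)
  · intro h A hA D hAD hDU
    refine h ?_
    intro X hX
    rcases hX with hX | hX <;> rw [hX]
    · exact hDU
    · exact W.weaken hAD hA

instance : Order.Frame (Opens T) :=
  Order.Frame.ofMinimalAxioms
    { inf_sSup_le_iSup_inf := fun _ 𝒱 => by
        rw [← le_imp_iff]
        refine sSup_le fun V hV => ?_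
        rw [le_imp_iff]
        exact le_iSup₂_of_le V hV le_rfl }

/-- The open given by a proposition symbol: the least open which that symbol entails. -/
def gen (s : S) : Opens T := sInf {U : Opens T | {s} ∈ U.carrier}

end Opens

/-! ### Maps of locales, points, and the specialisation order -/

/-- The specialisation order on the maps `A ⟶ B` of locales: `f ⊑ g` iff `f⁻¹ U ≤ g⁻¹ U` for every
open `U` of `B`. -/
instance instPartialOrderHom (A B : Locale.{u}) : PartialOrder (A ⟶ B) :=
  PartialOrder.lift (fun f U => f.unop.hom U) fun _ _ h =>
    Quiver.Hom.unop_inj (Frm.ext fun U => congrFun h U)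

/-- The set `Y` as a (discrete) locale: every subset is open. -/
abbrev discrete (Y : Type u) : Locale.{u} := Locale.of (Set Y)

/-- The element `q` of `Y` as a point of the discrete locale on `Y`. -/
def discretePoint {Y : Type u} (q : Y) : Locale.PT (Set Y) where
  toFun A := q ∈ A
  map_inf' _ _ := rfl
  map_top' := rfl
  map_sSup' 𝒜 := by simp [Prop.exists_iff]

/-- The value `f q` of a map `f : Y ⟶ X` at `q`, a point of `X`; the open `U` contains it iff
`q ∈ f⁻¹ U`. Points of `X` carry the specialisation order `p ≤ p' ↔ ∀ U, p U → p' U`. -/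
def valueAt {Y : Type u} {X : Locale.{u}} (f : discrete Y ⟶ X) (q : Y) : Locale.PT X :=
  (discretePoint q).comp f.unop.hom

/-- `p` is the join of the set `s`, and `s` is directed. -/
structure IsDirectedJoin {α : Type*} [Preorder α] (s : Set α) (p : α) : Prop where
  nonempty : s.Nonempty
  directedOn : DirectedOn (· ≤ ·) s
  isLUB : IsLUB s p

/-! ### Ideals, R-structures and the rounded ideal completion -/

section RoundedIdeals

variable (Y : Type u) [LT Y]

variable {Y} in
/-- An ideal: a subset which is downward closed and contains a (`<`-)upper bound of each of its
finite subsets. -/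
structure IsIdeal (I : Set Y) : Prop where
  lower : ∀ ⦃a b : Y⦄, a < b → b ∈ I → a ∈ I
  exists_upper : ∀ F : Finset Y, ↑F ⊆ I → ∃ b ∈ I, ∀ a ∈ F, a < b

/-- `(Y, <)` is an R-structure. The order need not be irreflexive. -/
structure IsRStructure : Prop where
  trans : ∀ ⦃a b c : Y⦄, a < b → b < c → a < c
  dense : ∀ ⦃a b : Y⦄, a < b → ∃ c, a < c ∧ c < b
  isIdeal : ∀ q : Y, IsIdeal {a : Y | a < q}

/-- The theory of ideals of `Y`. Its symbols are the elements of `Y`, with `y` standing for `y ∈ I`.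
Its axioms are `b ⇒ a` for `a < b`, and `⋀ F ⇒ ⋁ {b | ∀ a ∈ F, a < b}` for `F` finite. -/
def idealTheory : Theory Y :=
  {σ | ∃ a b : Y, a < b ∧ σ = ⟨{b}, {{a}}⟩} ∪
  {σ | ∃ F : Finset Y, σ = ⟨F, {B | ∃ b : Y, (∀ a ∈ F, a < b) ∧ B = {b}}⟩}

/-- The rounded ideal completion of `Y`: the localic space of ideals of `Y`, that is, of models of
the theory of ideals. -/
abbrev RIdl : Locale.{u} := Locale.of (Opens (idealTheory Y))

variable {Y} in
/-- The ideal which a point of the rounded ideal completion is: it consists of the `y` such that the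
point satisfies the proposition `y ∈ I`. -/
def idealOf (p : Locale.PT (Opens (idealTheory Y))) : Set Y := {y | p (Opens.gen y)}

/-- The two lifting conditions on a map from `Y` to `X`. -/
structure IsLiftable {X : Locale.{u}} (f : discrete Y ⟶ X) : Prop where
  monotone : ∀ q' q : Y, q' < q → valueAt f q' ≤ valueAt f q
  continuous : ∀ q : Y, IsDirectedJoin (valueAt f '' {q' : Y | q' < q}) (valueAt f q)

end RoundedIdeals

end LiftingLemma

/-! The inverse image of `φ` is `extent`. The directedness axiom for a finite `A` says that `A` is
covered by its strict upper bounds, so an open is determined by its extent (`mem_carrier_iff`).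
Hence `extent` is an order embedding of frames and `φ` is epi. Its image consists of the sets that
are upward closed and rounded, i.e. each member has another member (possibly itself) strictly below
it (`extent_openOfSet`).

For `f : Y ⟶ X`, monotonicity says that the sets `f⁻¹ U` are upward closed, and continuity makes
them rounded because directed joins of points are computed openwise. So `f` is liftable exactly when
its inverse image factors through `extent`, and the factorisation is unique. -/

namespace LiftingLemma

/-! ### Opens of the completion as subsets of `Y` -/

section Extent

variable {Y : Type u} [LT Y]

/-- The set of those `q` whose ideal `{a | a < q}` lies in the open `U`. -/
def extent (U : Opens (idealTheory Y)) : Set Y :=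
  {q | ∃ A ∈ U.carrier, ∀ a ∈ A, a < q}

/-- Cut with the axioms `b ⇒ a`, one for each `a ∈ B`. -/
theorem mem_carrier_of_forall_lt {U : Opens (idealTheory Y)} {b : Y} {B C : Finset Y}
    (hB : B ∈ U.carrier) (hb : b ∈ C) (h : ∀ a ∈ B, a < b) : C ∈ U.carrier := by
  classical
  -- The context `C` is generalised because each cut replaces it by a larger one.
  suffices H : ∀ B' : Finset Y, (∀ a ∈ B', a < b) → ∀ C : Finset Y, b ∈ C →
      C ∪ B' ∈ U.carrier → C ∈ U.carrier from
    H B h C hb (U.weaken Finset.subset_union_right hB)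
  intro B'
  induction B' using Finset.induction_on with
  | empty => intro _ C _ hC; simpa using hC
  | insert a s _ ih =>
    intro hlt C hbC hC
    refine U.cover ⟨{b}, {{a}}⟩ (Or.inl ⟨a, b, hlt a (Finset.mem_insert_self a s), rfl⟩) C
      (by simpa using hbC) ?_
    rintro _ rfl D hCD haD
    refine ih (fun c hc => hlt c (Finset.mem_insert_of_mem hc)) D (hCD hbC) (U.weaken ?_ hC)
    intro x hx
    simp only [Finset.mem_union, Finset.mem_insert] at hx ⊢
    rcases hx with hx | rfl | hx
    · exact Or.inl (hCD hx)
    · exact Or.inl (haD (Finset.mem_singleton_self _))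
    · exact Or.inr hx

/-- An open contains a finite conjunction as soon as it contains the ideals of all its strict upper
bounds. -/
theorem mem_carrier_iff {U : Opens (idealTheory Y)} {A : Finset Y} :
    A ∈ U.carrier ↔ ∀ b, (∀ a ∈ A, a < b) → b ∈ extent U := by
  refine ⟨fun hA b hb => ⟨A, hA, hb⟩, fun h => ?_⟩
  refine U.cover ⟨A, _⟩ (Or.inr ⟨A, rfl⟩) A subset_rfl ?_
  rintro _ ⟨b, hb, rfl⟩ D _ hbD
  obtain ⟨B, hB, hlt⟩ := h b hb
  exact mem_carrier_of_forall_lt hB (hbD (Finset.mem_singleton_self b)) hlt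

theorem extent_subset_extent_iff {U V : Opens (idealTheory Y)} :
    extent U ⊆ extent V ↔ U ≤ V :=
  ⟨fun h _ hA => mem_carrier_iff.2 fun b hb => h (mem_carrier_iff.1 hA b hb),
    fun h _ ⟨A, hA, hlt⟩ => ⟨A, h hA, hlt⟩⟩

theorem extent_injective : Function.Injective (extent : Opens (idealTheory Y) → Set Y) :=
  fun _ _ h => le_antisymm (extent_subset_extent_iff.1 h.le) (extent_subset_extent_iff.1 h.ge)

/-- The largest open whose extent is contained in `W`. -/
def openOfSet (hY : IsRStructure Y) (W : Set Y) : Opens (idealTheory Y) where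
  carrier := {A | ∀ b, (∀ a ∈ A, a < b) → b ∈ W}
  weaken _ _ h hA b hb := hA b fun a ha => hb a (h ha)
  cover := by
    classical
    rintro σ (⟨a, b, hab, rfl⟩ | ⟨F, rfl⟩) C hC h e he
    · refine h {a} rfl (C ∪ {a}) Finset.subset_union_left Finset.subset_union_right e ?_
      intro x hx
      rcases Finset.mem_union.1 hx with hx | hx
      · exact he x hx
      · rw [Finset.mem_singleton.1 hx]
        exact hY.trans hab (he b (hC (Finset.mem_singleton_self b)))
    -- Since `e` strictly bounds `F`, the ideal below `e` contains some `b` strictly above `F`; this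
    -- `b` selects the disjunct.
    · obtain ⟨b, hbe, hb⟩ := (hY.isIdeal e).exists_upper F fun x hx => he x (hC hx)
      refine h {b} ⟨b, hb, rfl⟩ (C ∪ {b}) Finset.subset_union_left Finset.subset_union_right e ?_
      intro x hx
      rcases Finset.mem_union.1 hx with hx | hx
      · exact he x hx
      · rw [Finset.mem_singleton.1 hx]
        exact hbe

theorem gc_extent_openOfSet (hY : IsRStructure Y) :
    GaloisConnection (extent : Opens (idealTheory Y) → Set Y) (openOfSet hY) :=
  fun _ _ => ⟨fun h A hA _ hb => h ⟨A, hA, hb⟩, fun h _ ⟨_, hA, hb⟩ => h hA _ hb⟩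

/-- The extents of opens are the upper sets all of whose elements are strictly above another. -/
theorem extent_openOfSet (hY : IsRStructure Y) {W : Set Y} (hup : ∀ ⦃a b⦄, a < b → a ∈ W → b ∈ W)
    (hround : ∀ b ∈ W, ∃ a, a < b ∧ a ∈ W) : extent (openOfSet hY W) = W := by
  refine Set.Subset.antisymm ((gc_extent_openOfSet hY).l_u_le W) fun b hb => ?_
  obtain ⟨a, hab, ha⟩ := hround b hb
  refine ⟨{a}, fun c hc => hup (hc a (Finset.mem_singleton_self a)) ha, fun c hc => ?_⟩
  rwa [Finset.mem_singleton.1 hc]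

theorem extent_upper (hY : IsRStructure Y) (U : Opens (idealTheory Y)) ⦃a b : Y⦄ (hab : a < b)
    (ha : a ∈ extent U) : b ∈ extent U := by
  obtain ⟨A, hA, h⟩ := ha
  exact ⟨A, hA, fun x hx => hY.trans (h x hx) hab⟩

theorem extent_rounded (hY : IsRStructure Y) (U : Opens (idealTheory Y)) (b : Y)
    (hb : b ∈ extent U) : ∃ a, a < b ∧ a ∈ extent U := by
  obtain ⟨A, hA, h⟩ := hb
  obtain ⟨a, hab, ha⟩ := (hY.isIdeal b).exists_upper A h
  exact ⟨a, hab, A, hA, ha⟩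

theorem mem_extent_gen (hY : IsRStructure Y) {y q : Y} : q ∈ extent (Opens.gen y) ↔ y < q := by
  constructor
  -- `Opens.gen y` is the least open entailed by `y`, so any such open bounds its extent.
  · have h : Opens.gen y ≤ openOfSet hY {b | y < b} :=
      sInf_le fun b hb => hb y (Finset.mem_singleton_self y)
    exact fun hq => (gc_extent_openOfSet hY).l_le h hq
  · exact fun h => ⟨{y}, fun _ hU => hU, fun a ha => by rwa [Finset.mem_singleton.1 ha]⟩

/-- `extent` as a homomorphism of frames. -/
def extentHom (hY : IsRStructure Y) : FrameHom (Opens (idealTheory Y)) (Set Y) where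
  toFun := extent
  map_inf' U V := by
    classical
    refine Set.Subset.antisymm
      (le_inf ((gc_extent_openOfSet hY).monotone_l inf_le_left)
        ((gc_extent_openOfSet hY).monotone_l inf_le_right)) ?_
    rintro q ⟨⟨A, hA, hAq⟩, ⟨B, hB, hBq⟩⟩
    refine ⟨A ∪ B, ?_, fun x hx => (Finset.mem_union.1 hx).elim (hAq x) (hBq x)⟩
    rintro X (rfl | rfl)
    · exact X.weaken Finset.subset_union_left hA
    · exact X.weaken Finset.subset_union_right hB
  map_top' := Set.eq_univ_of_forall fun _ =>
    ⟨∅, (le_sInf fun _ h => h.elim : sInf ∅ ≤ (⊤ : Opens (idealTheory Y))) fun _ h => h.elim,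
      fun a ha => absurd ha (Finset.notMem_empty a)⟩
  map_sSup' 𝒰 := by
    rw [(gc_extent_openOfSet hY).l_sSup, sSup_image]

/-- The map from `Y` to its rounded ideal completion which sends `q` to `{a | a < q}`. -/
def toRIdl (hY : IsRStructure Y) : discrete Y ⟶ RIdl Y :=
  (Frm.ofHom (extentHom hY)).op

/-- An injective frame homomorphism can be cancelled, which dually makes the map of locales epi. -/
theorem epi_toRIdl (hY : IsRStructure Y) : Epi (toRIdl hY) where
  left_cancellation _ _ h := Quiver.Hom.unop_inj <| Frm.ext fun U => extent_injective <|
    congrArg (fun k : discrete Y ⟶ _ => k.unop.hom U) h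

theorem idealOf_valueAt_toRIdl (hY : IsRStructure Y) (q : Y) :
    idealOf (valueAt (toRIdl hY) q) = {q' : Y | q' < q} :=
  Set.ext fun _ => mem_extent_gen hY

end Extent

/-! ### Directed joins of points and the lifting -/

section Lifting

variable {Y : Type u} {X : Locale.{u}}

/-- A point of `X` which is the union of a directed set of points is their join. -/
theorem isLUB_of_forall_iff {s : Set (Locale.PT X)} {p : Locale.PT X}
    (h : ∀ U, p U ↔ ∃ p' ∈ s, p' U) : IsLUB s p :=
  ⟨fun p' hp' U hU => (h U).2 ⟨p', hp', hU⟩, fun p'' hp'' U hU => by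
    obtain ⟨p', hp', hU'⟩ := (h U).1 hU
    exact hp'' hp' U hU'⟩

/-- The union of a directed set of points. -/
def directedUnion (s : Set (Locale.PT X)) (hne : s.Nonempty) (hs : DirectedOn (· ≤ ·) s) :
    Locale.PT X where
  toFun U := ∃ p ∈ s, p U
  map_inf' U V := by
    apply propext
    constructor
    · rintro ⟨p, hp, h⟩
      rw [map_inf] at h
      exact ⟨⟨p, hp, h.1⟩, ⟨p, hp, h.2⟩⟩
    · rintro ⟨⟨p, hp, hU⟩, ⟨p', hp', hV⟩⟩
      obtain ⟨r, hr, hpr, hpr'⟩ := hs p hp p' hp'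
      refine ⟨r, hr, ?_⟩
      rw [map_inf]
      exact ⟨hpr U hU, hpr' V hV⟩
  map_top' := eq_true <| hne.imp fun p hp => ⟨hp, by rw [map_top]; trivial⟩
  map_sSup' 𝒰 := by
    apply propext
    simp only [map_sSup, sSup_Prop_eq, Set.mem_image]
    constructor
    · rintro ⟨p, hp, _, ⟨U, hU, rfl⟩, h⟩
      exact ⟨_, ⟨U, hU, rfl⟩, p, hp, h⟩
    · rintro ⟨_, ⟨U, hU, rfl⟩, p, hp, h⟩
      exact ⟨p, hp, _, ⟨U, hU, rfl⟩, h⟩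

/-- Directed joins of points are computed openwise. -/
theorem IsDirectedJoin.apply_iff {s : Set (Locale.PT X)} {p : Locale.PT X}
    (h : IsDirectedJoin s p) (U : X.unop) : p U ↔ ∃ p' ∈ s, p' U := by
  -- The directed union is itself a point, hence a join of `s`, and joins are unique.
  have : p = directedUnion s h.nonempty h.directedOn :=
    h.isLUB.unique (isLUB_of_forall_iff fun _ => Iff.rfl)
  rw [this]
  rfl

variable [LT Y]

theorem isLiftable_comp (hY : IsRStructure Y) (g : RIdl Y ⟶ X) :
    IsLiftable Y (toRIdl hY ≫ g) := by
  have hmono : ∀ q' q : Y, q' < q →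
      valueAt (toRIdl hY ≫ g) q' ≤ valueAt (toRIdl hY ≫ g) q :=
    fun q' q h U hU => extent_upper hY (g.unop.hom U) h hU
  refine ⟨hmono, fun q => ⟨?_, ?_, isLUB_of_forall_iff fun U => ⟨fun hU => ?_, ?_⟩⟩⟩
  · obtain ⟨b, hb, -⟩ := (hY.isIdeal q).exists_upper ∅ (by simp)
    exact ⟨_, b, hb, rfl⟩
  · classical
    rintro _ ⟨a, ha, rfl⟩ _ ⟨b, hb, rfl⟩
    obtain ⟨c, hc, h⟩ := (hY.isIdeal q).exists_upper {a, b} (by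
      simpa [Set.insert_subset_iff] using And.intro ha hb)
    exact ⟨_, ⟨c, hc, rfl⟩, hmono a c (h a (by simp)), hmono b c (h b (by simp))⟩
  · obtain ⟨a, ha, haU⟩ := extent_rounded hY (g.unop.hom U) q hU
    exact ⟨_, ⟨a, ha, rfl⟩, haU⟩
  · rintro ⟨_, ⟨a, ha, rfl⟩, haU⟩
    exact hmono a q ha U haU

theorem IsLiftable.extent_openOfSet (hY : IsRStructure Y) {f : discrete Y ⟶ X}
    (hf : IsLiftable Y f) (U : X.unop) : extent (openOfSet hY (f.unop.hom U)) = f.unop.hom U := by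
  refine LiftingLemma.extent_openOfSet hY (fun a b hab ha => hf.monotone a b hab U ha)
    fun b hb => ?_
  obtain ⟨_, ⟨a, ha, rfl⟩, haU⟩ := ((hf.continuous b).apply_iff U).1 hb
  exact ⟨a, ha, haU⟩

/-- The extension of a liftable map to the rounded ideal completion. -/
def lift (hY : IsRStructure Y) (f : discrete Y ⟶ X) (hf : IsLiftable Y f) : RIdl Y ⟶ X :=
  Quiver.Hom.op <| Frm.ofHom (X := X.unop)
    { toFun := fun U => openOfSet hY (f.unop.hom U)
      -- Each law is checked after applying the injective `extent`, where it becomes the same law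
      -- for `f`.
      map_inf' := fun U V => extent_injective <| by
        change _ = extentHom hY _
        rw [map_inf (extentHom hY), hf.extent_openOfSet, map_inf f.unop.hom]
        exact congrArg₂ _ (hf.extent_openOfSet hY U).symm (hf.extent_openOfSet hY V).symm
      map_top' := extent_injective <| by
        change _ = extentHom hY _
        rw [map_top (extentHom hY), hf.extent_openOfSet, map_top f.unop.hom]
        rfl
      map_sSup' := fun 𝒰 => extent_injective <| by
        change _ = extentHom hY _
        rw [map_sSup (extentHom hY), hf.extent_openOfSet, map_sSup f.unop.hom, Set.image_image]
        exact congrArg sSup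
          (Set.image_congr fun U _ => (hf.extent_openOfSet hY U).symm) }

theorem toRIdl_lift (hY : IsRStructure Y) (f : discrete Y ⟶ X) (hf : IsLiftable Y f) :
    toRIdl hY ≫ lift hY f hf = f :=
  Quiver.Hom.unop_inj <| Frm.ext fun U => hf.extent_openOfSet hY U

/-- Composition with `toRIdl` is an isomorphism onto the poset of liftable maps. -/
def liftEquiv (hY : IsRStructure Y) (X : Locale.{u}) :
    (RIdl Y ⟶ X) ≃o {f : discrete Y ⟶ X // IsLiftable Y f} where
  toFun g := ⟨toRIdl hY ≫ g, isLiftable_comp hY g⟩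
  invFun f := lift hY f.1 f.2
  left_inv _ := (epi_toRIdl hY).left_cancellation _ _ (toRIdl_lift hY _ _)
  right_inv f := Subtype.ext (toRIdl_lift hY f.1 f.2)
  map_rel_iff' := forall_congr' fun _ => extent_subset_extent_iff

end Lifting

end LiftingLemma

theorem mainTheorem6 {Y : Type u} [LT Y] (hY : LiftingLemma.IsRStructure Y) :
    ∃ φ : LiftingLemma.discrete Y ⟶ LiftingLemma.RIdl Y,
      Epi φ ∧
      (∀ q : Y, LiftingLemma.idealOf (LiftingLemma.valueAt φ q) = {q' : Y | q' < q}) ∧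
      ∀ X : Locale.{u},
        ∃ e : (LiftingLemma.RIdl Y ⟶ X) ≃o
            {f : LiftingLemma.discrete Y ⟶ X // LiftingLemma.IsLiftable Y f},
          ∀ g : LiftingLemma.RIdl Y ⟶ X, (e g : LiftingLemma.discrete Y ⟶ X) = φ ≫ g :=
  ⟨LiftingLemma.toRIdl hY, LiftingLemma.epi_toRIdl hY, LiftingLemma.idealOf_valueAt_toRIdl hY,
    fun X => ⟨LiftingLemma.liftEquiv hY X, fun _ => rfl⟩⟩
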